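/- An uncertain point set $P=\{p_1,\dots,p_n\}$ ($n\ge 1$) consists of uncertain points, where $p_i$ lies at one of $k$ given locations $p_{i,1},\dots,p_{i,k}\in\mathbb R^d$, at $p_{i,j}$ with probability $w_{i,j}\ge 0$, $\sum_{j}w_{i,j}=1$ (for instance $w_{i,j}=1/k$), independently of the other points. A transversal $Q=(q_1,\dots,q_n)\Subset P$ is a random instantiation of $P$ according to this distribution. For a range $r\subseteq\mathbb R^d$ let $r(Q)=|\{i: q_i\in r\}|/|Q|$ and $E_{r(P)}=\mathbf E_{Q\Subset P}[r(Q)]$. Let $\mathcal A$ be a family of ranges. A subset (or a multiset) $T$ of points of $P$, taken with their distributions, is an $\varepsilon$-RE coreset of $(P,\mathcal A)$ if $|E_{r(P)}-E_{r(T)}|\le\varepsilon$ for all $r\in\mathcal A$. Let $P_{\mathsf{cert}}=\{p_{i,j}\}$ be the set of all possible locations. Theorem. There is an absolute constant $C>0$ such that the following holds. Let $P$ and $\mathcal A$ be as above, let the range space $(P_{\mathsf{cert}},\mathcal A)$ have VC-dimension at most $\nu$, and let $0<\varepsilon\le 1$ and $0<\delta<1$; in the degenerate case $\nu=0$, $k=1$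 assume also $\delta\le 1/2$. Then for every integer $$m\ \ge\ \frac{C}{\varepsilon^2}\Bigl(\nu+\log\frac{k}{\delta}\Bigr),$$ a uniform random sample $T$ of $m$ points of $P$ is an $\varepsilon$-RE coreset of $(P,\mathcal A)$ with probability at least $1-\delta$. This holds both when $T$ is a uniformly random subset of $P$ of size $\min(m,n)$ and when $T$ consists of $m$ independent uniform draws from $P$ with replacement. -/

import Mathlib

/-- An uncertain point in `ℝ^d` with `k` possible locations: it lies at `loc j` with probability
`prob j`. (The listed locations are allowed to coincide; the uniform distribution is `prob j = 1/k`.) -/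
structure UncertainPoint (d k : ℕ) where
  loc : Fin k → EuclideanSpace ℝ (Fin d)
  prob : Fin k → ℝ
  prob_nonneg : ∀ j, 0 ≤ prob j
  prob_sum : ∑ j, prob j = 1

namespace UncertainPoint

variable {d k : ℕ} {ι κ : Type*}

/-- `r(Q) = |Q ∩ r| / |Q|` for a (certain) point set `Q = (q_i)_i`, points counted with multiplicity. -/
noncomputable def density [Fintype ι] (Q : ι → EuclideanSpace ℝ (Fin d))
    (r : Set (EuclideanSpace ℝ (Fin d))) : ℝ :=
  (Nat.card {i : ι // Q i ∈ r} : ℝ) / (Fintype.card ι : ℝ)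

/-- The transversal of `P` in which the `i`-th point takes its `φ i`-th location. -/
def transversal (P : ι → UncertainPoint d k) (φ : ι → Fin k) : ι → EuclideanSpace ℝ (Fin d) :=
  fun i => (P i).loc (φ i)

/-- `E_{r(P)}`: the expectation of `r(Q)` over a random transversal `Q` of `P`, in which the
locations of the points are chosen independently. -/
noncomputable def expectedDensity [Fintype ι] (P : ι → UncertainPoint d k)
    (r : Set (EuclideanSpace ℝ (Fin d))) : ℝ :=
  open scoped Classical in
  ∑ φ : ι → Fin k, (∏ i, (P i).prob (φ i)) * density (transversal P φ) r

/-- The subfamily `T = (P (s j))_j` of `P` is an `ε`-RE coreset of `(P, 𝒜)`. -/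
def IsRECoreset [Fintype ι] [Fintype κ] (ε : ℝ) (𝒜 : Set (Set (EuclideanSpace ℝ (Fin d))))
    (P : ι → UncertainPoint d k) (s : κ → ι) : Prop :=
  ∀ r ∈ 𝒜, |expectedDensity P r - expectedDensity (P ∘ s) r| ≤ ε

open scoped Classical in
/-- `P_cert`: the set of all locations of all points of `P`. -/
noncomputable def cert [Fintype ι] (P : ι → UncertainPoint d k) :
    Finset (EuclideanSpace ℝ (Fin d)) :=
  Finset.univ.image fun x : ι × Fin k => (P x.1).loc x.2

end UncertainPoint

open scoped Classical in
/-- The subsets of the finite ground set `X` cut out by the ranges in `𝒜`. -/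
noncomputable def rangeTraces {α : Type*} (X : Finset α) (𝒜 : Set (Set α)) : Finset (Finset α) :=
  X.powerset.filter fun t => ∃ r ∈ 𝒜, (t : Set α) = (X : Set α) ∩ r

open scoped Classical in
/-- The VC-dimension of the range space `(X, 𝒜)`. -/
noncomputable def rangeSpaceVCDim {α : Type*} (X : Finset α) (𝒜 : Set (Set α)) : ℕ :=
  (rangeTraces X 𝒜).vcDim

/-- `m` independent uniform draws (with replacement) from `n` objects. -/
noncomputable def uniformDraws (n m : ℕ) [NeZero n] : PMF (Fin m → Fin n) :=
  PMF.uniformOfFintype (Fin m → Fin n)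

/-- A uniformly random subset of size `m` of `n` objects (all of them if `m > n`). -/
noncomputable def uniformSubset (n m : ℕ) : PMF (Finset (Fin n)) :=
  PMF.uniformOfFinset (Finset.powersetCard (min m n) Finset.univ)
    (Finset.powersetCard_nonempty.mpr (by simp))

/-!
The expected density of a range `r` is the mean over the points of the probabilities
`f_t i = ∑ l, w_{i,l} * 1[p_{i,l} ∈ t]`, where `t = P_cert ∩ r` is the trace of `r`
(`UncertainPoint.expectedDensity_eq`). So a sample is a coreset as soon as `∑ j, (f_t (s j) - mean)`
is at most `ε * m` in absolute value for all traces `t` at once, and it suffices to bound the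
exponential moment of the supremum over `t` of these sums.

The process is controlled by chaining. Two traces are compared by the weight, among the sampled
locations, of their symmetric difference; for this pseudo-distance a family of VC-dimension `ν` has
`ε`-nets of size `2 * (4 / ε) ^ (2 * ν)` (`card_le_of_separated`, `exists_net`): a short random
sequence of locations tells the members of a separated family apart, and the Sauer–Shelah lemma
bounds the number of traces on it. Because `f_t i` is an average of indicators, this distance bounds
the variance of the differences `f_t - f_u`, so no dependence on the number of locations per point
enters. Symmetrization (`expect_symmetrization`) replaces the centred sums by Rademacher sums, and
for those each link of a chain through nets at the scales `(1 / 4) ^ i` is sub-Gaussian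
(`expect_supExp_link_le`). Splitting the exponential of the chain into a convex combination of
exponentials of rescaled links (`expect_supExp_chain_le`) gives the moment bound
`exp (O(ν)) * exp (O(lam ^ 2 * m))` without a factor `log (1 / ε)` in the exponent
(`expect_supExp_deviation_le`). Markov's inequality with `lam` proportional to `ε` then yields the
sample size.

Sampling a subset without replacement reduces to independent draws, since the bounded quantity is
the expectation of a convex function of the sum (`expect_powersetCard_le_expect_draws`).
When `ν = 0` there is a single trace and only the sub-Gaussian bound with its factor `2` is needed;
that factor is paid for by `log (k / δ) ≥ log 2`, which is where the degenerate case uses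
`δ ≤ 1 / 2`.
-/

open scoped BigOperators

/-! ### Packing numbers of families of bounded VC-dimension -/

/-- The Sauer–Shelah bound in generating-function form: the traces on `Y` of a family of
VC-dimension at most `ν` are counted by its shattered subsets of `Y`, each of which has at most `ν`
elements, and `∑ s ⊆ Y, x ^ #s = (1 + x) ^ #Y`. -/
theorem card_image_inter_mul_pow_le {α : Type*} [DecidableEq α] {𝒯 : Finset (Finset α)} {ν : ℕ}
    (hν : 𝒯.vcDim ≤ ν) (Y : Finset α) {x : ℝ} (hx0 : 0 ≤ x) (hx1 : x ≤ 1) :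
    ((𝒯.image (fun t => Y ∩ t)).card : ℝ) * x ^ ν ≤ (1 + x) ^ Y.card := by
  set ℬ := 𝒯.image (fun t => Y ∩ t) with hℬ
  have hsh : ∀ s ∈ ℬ.shatterer, s ⊆ Y ∧ s.card ≤ ν := by
    intro s hs
    rw [Finset.mem_shatterer] at hs
    have hsY : s ⊆ Y := by
      obtain ⟨u, hu, hsu⟩ := hs.exists_superset
      obtain ⟨t, -, rfl⟩ := Finset.mem_image.1 hu
      exact hsu.trans Finset.inter_subset_left
    refine ⟨hsY, le_trans (Finset.Shatters.card_le_vcDim ?_) hν⟩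
    intro u hu
    obtain ⟨v, hv, hvu⟩ := hs hu
    obtain ⟨t, ht, rfl⟩ := Finset.mem_image.1 hv
    refine ⟨t, ht, ?_⟩
    rw [← hvu, ← Finset.inter_assoc, Finset.inter_eq_left.2 hsY]
  calc (ℬ.card : ℝ) * x ^ ν ≤ (ℬ.shatterer.card : ℝ) * x ^ ν := by
        have := Finset.card_le_card_shatterer ℬ
        gcongr ?_ * _
        exact_mod_cast this
    _ = ∑ s ∈ ℬ.shatterer, x ^ ν := by simp
    _ ≤ ∑ s ∈ ℬ.shatterer, x ^ s.card :=
        Finset.sum_le_sum fun s hs => pow_le_pow_of_le_one hx0 hx1 (hsh s hs).2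
    _ ≤ ∑ s ∈ Y.powerset, x ^ s.card :=
        Finset.sum_le_sum_of_subset_of_nonneg
          (fun s hs => Finset.mem_powerset.2 (hsh s hs).1) fun s _ _ => by positivity
    _ = (1 + x) ^ Y.card := by
        have h := Finset.prod_one_add (f := fun _ : α => x) Y
        simpa using h.symm

open scoped Classical in
/-- The pseudo-distance of two sets `t`, `t'` under the image of the weights `p` along `loc`:
the total weight of the indices whose location lies in exactly one of `t` and `t'`. -/
noncomputable def symmDiffWeight {Ω α : Type*} [Fintype Ω] (p : Ω → ℝ) (loc : Ω → α)
    (t t' : Finset α) : ℝ :=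
  ∑ ω, if loc ω ∈ t ↔ loc ω ∈ t' then 0 else p ω

section Packing

variable {Ω α : Type*} [Fintype Ω] {p : Ω → ℝ} {loc : Ω → α}

theorem symmDiffWeight_comm (t t' : Finset α) :
    symmDiffWeight p loc t t' = symmDiffWeight p loc t' t := by
  unfold symmDiffWeight
  refine Finset.sum_congr rfl fun ω _ => ?_
  split_ifs <;> tauto

theorem symmDiffWeight_self (t : Finset α) : symmDiffWeight p loc t t = 0 := by
  simp [symmDiffWeight]

theorem symmDiffWeight_triangle (hp : ∀ ω, 0 ≤ p ω) (t u v : Finset α) :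
    symmDiffWeight p loc t v ≤ symmDiffWeight p loc t u + symmDiffWeight p loc u v := by
  unfold symmDiffWeight
  rw [← Finset.sum_add_distrib]
  refine Finset.sum_le_sum fun ω _ => ?_
  have := hp ω
  split_ifs <;> first | linarith | tauto

theorem symmDiffWeight_le_one (hp : ∀ ω, 0 ≤ p ω) (hp1 : ∑ ω, p ω = 1) (t t' : Finset α) :
    symmDiffWeight p loc t t' ≤ 1 := by
  rw [← hp1]
  unfold symmDiffWeight
  refine Finset.sum_le_sum fun ω _ => ?_
  have := hp ω
  split_ifs <;> linarith

/-- If finitely many sets are pairwise at distance more than `ε`, then some sequence of `M` indices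
tells all of them apart as soon as `(#𝒩) ^ 2 ≤ exp (ε * M)`: in a random sequence drawn according
to `p`, the expected number of ordered pairs that are not told apart is less than `1`. -/
theorem exists_separating_draws (hp : ∀ ω, 0 ≤ p ω) (hp1 : ∑ ω, p ω = 1) {ε : ℝ}
    {𝒩 : Finset (Finset α)} (h𝒩 : 𝒩.Nonempty)
    (hsep : ∀ a ∈ 𝒩, ∀ b ∈ 𝒩, a ≠ b → ε < symmDiffWeight p loc a b) {M : ℕ}
    (hM : (𝒩.card : ℝ) ^ 2 ≤ Real.exp (ε * M)) :
    ∃ x : Fin M → Ω, ∀ a ∈ 𝒩, ∀ b ∈ 𝒩, (∀ j, loc (x j) ∈ a ↔ loc (x j) ∈ b) → a = b := by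
  classical
  by_contra! hcon
  set f : Finset α → Finset α → Ω → ℝ :=
    fun a b ω => if loc ω ∈ a ↔ loc ω ∈ b then p ω else 0 with hf
  have hf0 : ∀ a b ω, 0 ≤ f a b ω := fun a b ω => by
    simp only [hf]; split_ifs; exacts [hp ω, le_rfl]
  have hfsum : ∀ a b, ∑ ω, f a b ω = 1 - symmDiffWeight p loc a b := by
    intro a b
    rw [eq_sub_iff_add_eq, symmDiffWeight, ← Finset.sum_add_distrib, ← hp1]
    refine Finset.sum_congr rfl fun ω _ => ?_
    simp only [hf]; split_ifs <;> simp
  have h1 : (1 : ℝ) ≤ ∑ x : Fin M → Ω, ∑ q ∈ 𝒩.offDiag, ∏ j, f q.1 q.2 (x j) := by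
    calc (1 : ℝ) = ∑ x : Fin M → Ω, ∏ j, p (x j) := by
          rw [← Fintype.sum_pow, hp1, one_pow]
      _ ≤ _ := by
          refine Finset.sum_le_sum fun x _ => ?_
          obtain ⟨a, ha, b, hb, hagree, hab⟩ := hcon x
          refine le_trans (le_of_eq ?_) (Finset.single_le_sum (f := fun q : Finset α × Finset α =>
            ∏ j, f q.1 q.2 (x j)) (fun q _ => Finset.prod_nonneg fun j _ => hf0 _ _ _)
            (Finset.mem_offDiag.2 ⟨ha, hb, hab⟩ : (a, b) ∈ 𝒩.offDiag))
          exact Finset.prod_congr rfl fun j _ => by simp only [hf]; rw [if_pos (hagree j)]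
  rw [Finset.sum_comm] at h1
  have h2 : ∑ q ∈ 𝒩.offDiag, ∑ x : Fin M → Ω, ∏ j, f q.1 q.2 (x j)
      ≤ ∑ q ∈ 𝒩.offDiag, Real.exp (-(ε * M)) := by
    refine Finset.sum_le_sum fun q hq => ?_
    obtain ⟨ha, hb, hab⟩ := Finset.mem_offDiag.1 hq
    rw [← Fintype.sum_pow, hfsum]
    have h3 := hsep _ ha _ hb hab
    calc (1 - symmDiffWeight p loc q.1 q.2) ^ M ≤ (Real.exp (-ε)) ^ M := by
          refine pow_le_pow_left₀ ?_ ?_ M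
          · linarith [symmDiffWeight_le_one (loc := loc) hp hp1 q.1 q.2]
          · linarith [Real.add_one_le_exp (-ε)]
      _ = Real.exp (-(ε * M)) := by rw [← Real.exp_nat_mul]; ring_nf
  have hN1 : 1 ≤ 𝒩.card := h𝒩.card_pos
  have hoff : ((𝒩.offDiag.card : ℕ) : ℝ) < (𝒩.card : ℝ) ^ 2 := by
    have hlt : 𝒩.offDiag.card < 𝒩.card * 𝒩.card := by
      rw [Finset.offDiag_card]
      exact Nat.sub_lt (by positivity) hN1
    rw [sq]; exact_mod_cast hlt
  rw [Finset.sum_const, nsmul_eq_mul, Real.exp_neg] at h2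
  have h4 : (1 : ℝ) ≤ 𝒩.offDiag.card * (Real.exp (ε * M))⁻¹ := h1.trans h2
  rw [← div_eq_mul_inv, one_le_div (Real.exp_pos _)] at h4
  linarith

/-- A packing bound: a family of VC-dimension at most `ν` contains at most `2 * (4 / ε) ^ (2 * ν)`
sets at pairwise distance more than `ε`. -/
theorem card_le_of_separated (hp : ∀ ω, 0 ≤ p ω) (hp1 : ∑ ω, p ω = 1) {ε : ℝ} (hε0 : 0 < ε)
    (hε1 : ε ≤ 1) {ν : ℕ} [DecidableEq α] {𝒩 : Finset (Finset α)} (hν : 𝒩.vcDim ≤ ν)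
    (hsep : ∀ a ∈ 𝒩, ∀ b ∈ 𝒩, a ≠ b → ε < symmDiffWeight p loc a b) :
    (𝒩.card : ℝ) ≤ 2 * (4 / ε) ^ (2 * ν) := by
  rcases 𝒩.eq_empty_or_nonempty with rfl | h𝒩
  · simp; positivity
  set N : ℝ := (𝒩.card : ℝ) with hN
  have hN1 : (1 : ℝ) ≤ N := by
    rw [hN]; exact_mod_cast h𝒩.card_pos
  have hN0 : 0 < N := by linarith
  -- the least number of draws for which the expected number of collisions is below `1`
  set M : ℕ := ⌈2 * Real.log N / ε⌉₊ with hMdef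
  have hM1 : 2 * Real.log N ≤ ε * M := by
    have := Nat.le_ceil (2 * Real.log N / ε)
    rw [div_le_iff₀ hε0] at this
    linarith
  have hM2 : (M : ℝ) ≤ 2 * Real.log N / ε + 1 :=
    (Nat.ceil_lt_add_one (by have := Real.log_nonneg hN1; positivity)).le
  obtain ⟨x, hx⟩ := exists_separating_draws (loc := loc) hp hp1 h𝒩 hsep (M := M) (by
    rw [← hN, ← Real.exp_log (pow_pos hN0 2), Real.log_pow]
    exact Real.exp_le_exp.2 (by push_cast; exact hM1))
  set Y : Finset α := Finset.univ.image fun j => loc (x j) with hY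
  have hinj : (𝒩.image (fun t => Y ∩ t)).card = 𝒩.card := by
    refine Finset.card_image_of_injOn fun a ha b hb hab => hx a ha b hb fun j => ?_
    have hj : loc (x j) ∈ Y := Finset.mem_image_of_mem _ (Finset.mem_univ j)
    have := Finset.ext_iff.1 hab (loc (x j))
    simpa [hj] using this
  have hYM : Y.card ≤ M := Finset.card_image_le.trans (by simp)
  have key := card_image_inter_mul_pow_le hν Y (x := ε / 4) (by positivity) (by linarith)
  rw [hinj, ← hN] at key
  have h5 : (1 + ε / 4) ^ Y.card ≤ Real.exp (1 / 4) * Real.exp (Real.log N / 2) := by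
    calc (1 + ε / 4) ^ Y.card ≤ (1 + ε / 4) ^ M := pow_le_pow_right₀ (by linarith) hYM
      _ ≤ Real.exp (ε / 4) ^ M :=
          pow_le_pow_left₀ (by positivity) (by linarith [Real.add_one_le_exp (ε / 4)]) M
      _ = Real.exp (M * (ε / 4)) := by rw [← Real.exp_nat_mul]
      _ ≤ Real.exp (1 / 4 + Real.log N / 2) := by
          refine Real.exp_le_exp.2 ?_
          have : (M : ℝ) * (ε / 4) ≤ (2 * Real.log N / ε + 1) * (ε / 4) := by gcongr
          have h6 : (2 * Real.log N / ε + 1) * (ε / 4) = Real.log N / 2 + ε / 4 := by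
            field_simp; ring
          linarith
      _ = _ := Real.exp_add _ _
  set s := Real.exp (Real.log N / 2) with hs
  have hsN : s ^ 2 = N := by
    rw [hs, ← Real.exp_nat_mul]; push_cast
    rw [mul_div_cancel₀ _ two_ne_zero, Real.exp_log hN0]
  have hs0 : 0 < s := Real.exp_pos _
  have h7 : s * (ε / 4) ^ ν ≤ Real.exp (1 / 4) := by
    have : s * (s * (ε / 4) ^ ν) ≤ s * Real.exp (1 / 4) := by
      calc s * (s * (ε / 4) ^ ν) = N * (ε / 4) ^ ν := by rw [← hsN]; ring
        _ ≤ _ := key.trans h5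
        _ = _ := mul_comm _ _
    exact le_of_mul_le_mul_left this hs0
  have h8 : s ≤ Real.exp (1 / 4) * (4 / ε) ^ ν := by
    calc s = s * (ε / 4) ^ ν * (4 / ε) ^ ν := by
          rw [mul_assoc, ← mul_pow]; field_simp; simp
      _ ≤ _ := by gcongr
  have h9 : Real.exp (1 / 4) ^ 2 ≤ 2 := by
    have h10 : (Real.exp (1 / 4) ^ 2) ^ 2 = Real.exp 1 := by
      rw [← pow_mul, ← Real.exp_nat_mul]; norm_num
    have := Real.exp_one_lt_d9
    nlinarith [sq_nonneg (Real.exp (1 / 4)), sq_nonneg (Real.exp (1 / 4) ^ 2)]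
  calc N = s ^ 2 := hsN.symm
    _ ≤ (Real.exp (1 / 4) * (4 / ε) ^ ν) ^ 2 := by gcongr
    _ = Real.exp (1 / 4) ^ 2 * (4 / ε) ^ (2 * ν) := by rw [mul_pow, ← pow_mul, mul_comm ν 2]
    _ ≤ _ := by gcongr

/-- A maximal `ε`-separated subfamily is an `ε`-net; `π` sends a set to a point of the net near
it. -/
theorem exists_net (hp : ∀ ω, 0 ≤ p ω) (hp1 : ∑ ω, p ω = 1) {ε : ℝ} (hε0 : 0 < ε)
    (hε1 : ε ≤ 1) {ν : ℕ} [DecidableEq α] {𝒯 : Finset (Finset α)} (hν : 𝒯.vcDim ≤ ν) :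
    ∃ π : Finset α → Finset α, (∀ t ∈ 𝒯, symmDiffWeight p loc t (π t) ≤ ε) ∧
      ((𝒯.image π).card : ℝ) ≤ 2 * (4 / ε) ^ (2 * ν) := by
  classical
  set S : Finset (Finset (Finset α)) := 𝒯.powerset.filter fun 𝒩 =>
    ∀ a ∈ 𝒩, ∀ b ∈ 𝒩, a ≠ b → ε < symmDiffWeight p loc a b with hS
  obtain ⟨𝒩, h𝒩S, hmax⟩ := S.exists_max_image Finset.card ⟨∅, by simp [hS]⟩
  rw [hS, Finset.mem_filter, Finset.mem_powerset] at h𝒩S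
  have hnet : ∀ t, ∃ u, t ∈ 𝒯 → u ∈ 𝒩 ∧ symmDiffWeight p loc t u ≤ ε := by
    intro t
    by_cases ht : t ∈ 𝒯
    swap
    · exact ⟨∅, fun h => absurd h ht⟩
    by_contra! hcon
    have hfar : ∀ u ∈ 𝒩, ε < symmDiffWeight p loc t u := fun u hu => (hcon u).2 hu
    have htN : t ∉ 𝒩 := fun h => by
      have := hfar t h
      rw [symmDiffWeight_self] at this
      linarith
    have hins : insert t 𝒩 ∈ S := by
      rw [hS, Finset.mem_filter, Finset.mem_powerset]
      refine ⟨Finset.insert_subset ht h𝒩S.1, fun a ha b hb hab => ?_⟩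
      rcases Finset.mem_insert.1 ha with rfl | ha'
      · rcases Finset.mem_insert.1 hb with rfl | hb'
        · exact absurd rfl hab
        · exact hfar b hb'
      · rcases Finset.mem_insert.1 hb with rfl | hb'
        · rw [symmDiffWeight_comm]; exact hfar a ha'
        · exact h𝒩S.2 a ha' b hb' hab
    have := hmax _ hins
    rw [Finset.card_insert_of_notMem htN] at this
    omega
  choose π hπ using hnet
  refine ⟨π, fun t ht => (hπ t ht).2, ?_⟩
  have hsub : 𝒯.image π ⊆ 𝒩 := Finset.image_subset_iff.2 fun t ht => (hπ t ht).1
  calc ((𝒯.image π).card : ℝ) ≤ 𝒩.card := by exact_mod_cast Finset.card_le_card hsub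
    _ ≤ _ := card_le_of_separated hp hp1 hε0 hε1
        ((Finset.vcDim_mono h𝒩S.1).trans hν) h𝒩S.2

end Packing

/-! ### Symmetrization, and sampling without replacement -/

/-- Integrating out all coordinates but one of a product of probability weights. -/
theorem sum_prod_mul_apply {ι κ : Type*} [Fintype ι] [DecidableEq ι] [Fintype κ]
    {p : ι → κ → ℝ} (hp : ∀ i, ∑ j, p i j = 1) (i₀ : ι) (h : κ → ℝ) :
    ∑ φ : ι → κ, (∏ i, p i (φ i)) * h (φ i₀) = ∑ j, p i₀ j * h j := by
  have h1 : ∀ φ : ι → κ, (∏ i, p i (φ i)) * h (φ i₀)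
      = ∏ i, p i (φ i) * (if i = i₀ then h (φ i) else 1) := by
    intro φ
    rw [Finset.prod_mul_distrib]
    simp
  simp_rw [h1]
  have h2 := Finset.prod_univ_sum (fun _ : ι => (Finset.univ : Finset κ))
    (fun i j => p i j * (if i = i₀ then h j else 1))
  rw [Fintype.piFinset_univ] at h2
  rw [← h2, Finset.prod_eq_single i₀]
  · simp
  · intro i _ hi
    simp [hi, hp i]
  · simp

theorem expect_pi_apply {ι κ : Type*} [Fintype ι] [Nonempty ι] [Fintype κ] [DecidableEq κ]
    (j : κ) (h : ι → ℝ) : 𝔼 s : κ → ι, h (s j) = 𝔼 i, h i := by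
  have h1 := sum_prod_mul_apply (p := fun (_ : κ) (_ : ι) => (Fintype.card ι : ℝ)⁻¹)
    (by simp) j h
  simp only [Finset.prod_const, ← Finset.mul_sum] at h1
  rw [Fintype.expect_eq_sum_div_card, Fintype.expect_eq_sum_div_card, div_eq_inv_mul,
    div_eq_inv_mul, ← h1, Fintype.card_fun]
  simp

/-- Jensen's inequality for uniform averages. -/
theorem ConvexOn.map_expect_le {ι T : Type*} [Fintype ι] [Nonempty ι] {Φ : (T → ℝ) → ℝ}
    (hΦ : ConvexOn ℝ Set.univ Φ) (g : ι → T → ℝ) :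
    Φ (fun t => 𝔼 i, g i t) ≤ 𝔼 i, Φ (g i) := by
  have h := hΦ.map_sum_le (t := Finset.univ) (w := fun _ : ι => (Fintype.card ι : ℝ)⁻¹) (p := g)
    (by intros; positivity) (by simp) (by simp)
  refine le_trans (le_of_eq ?_) (h.trans (le_of_eq ?_))
  · congr 1
    ext t
    simp [Fintype.expect_eq_sum_div_card, div_eq_inv_mul, Finset.mul_sum]
  · simp [Fintype.expect_eq_sum_div_card, div_eq_inv_mul, Finset.mul_sum]

/-- The sign `±1` encoded by a boolean. -/
def boolSign (b : Bool) : ℝ := if b then 1 else -1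

/-- Symmetrization: deviations from the mean are compared with random signed sums. The mean is
replaced by an independent copy of the sample (Jensen), exchanging the two copies in the coordinates
of negative sign does not change the joint distribution, and convexity separates them again. -/
theorem expect_symmetrization {ι κ T : Type*} [Fintype ι] [Nonempty ι] [Fintype κ] [DecidableEq κ]
    {Φ : (T → ℝ) → ℝ} (hΦ : ConvexOn ℝ Set.univ Φ) (heven : ∀ v, Φ (-v) = Φ v) (F : ι → T → ℝ) :
    𝔼 s : κ → ι, Φ (fun t => ∑ j, (F (s j) t - 𝔼 i, F i t)) ≤
      𝔼 s : κ → ι, 𝔼 ξ : κ → Bool, Φ (fun t => 2 * ∑ j, boolSign (ξ j) * F (s j) t) := by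
  set R : (κ → Bool) → (κ → ι) → T → ℝ := fun ξ s t => 2 * ∑ j, boolSign (ξ j) * F (s j) t with hR
  have step1 : ∀ s : κ → ι, Φ (fun t => ∑ j, (F (s j) t - 𝔼 i, F i t)) ≤
      𝔼 s' : κ → ι, Φ (fun t => ∑ j, (F (s j) t - F (s' j) t)) := by
    intro s
    have h := hΦ.map_expect_le (fun (s' : κ → ι) t => ∑ j, (F (s j) t - F (s' j) t))
    refine le_trans (le_of_eq ?_) h
    congr 1
    ext t
    rw [Finset.expect_sum_comm]
    refine Finset.sum_congr rfl fun j _ => ?_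
    rw [Finset.expect_sub_distrib, Fintype.expect_const, expect_pi_apply j (fun i => F i t)]
  have step2 : ∀ ξ : κ → Bool,
      𝔼 s : κ → ι, 𝔼 s' : κ → ι, Φ (fun t => ∑ j, (F (s j) t - F (s' j) t)) =
      𝔼 s : κ → ι, 𝔼 s' : κ → ι, Φ (fun t => ∑ j, boolSign (ξ j) * (F (s j) t - F (s' j) t)) := by
    intro ξ
    rw [← Finset.expect_product', ← Finset.expect_product', Finset.univ_product_univ]
    let sw : (κ → ι) × (κ → ι) → (κ → ι) × (κ → ι) := fun q =>
      (fun j => if ξ j then q.1 j else q.2 j, fun j => if ξ j then q.2 j else q.1 j)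
    have hsw : Function.Involutive sw := by
      intro q
      ext j <;> cases h : ξ j <;> simp [sw, h]
    refine Fintype.expect_equiv hsw.toPerm _ _ fun q => ?_
    congr 1
    ext t
    refine Finset.sum_congr rfl fun j _ => ?_
    cases h : ξ j <;> simp [Function.Involutive.toPerm, sw, boolSign, h]
  have step3 : ∀ ξ s s', Φ (fun t => ∑ j, boolSign (ξ j) * (F (s j) t - F (s' j) t)) ≤
      1 / 2 * Φ (R ξ s) + 1 / 2 * Φ (R ξ s') := by
    intro ξ s s'
    have h := hΦ.2 (Set.mem_univ (R ξ s)) (Set.mem_univ (-(R ξ s')))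
      (by norm_num : (0 : ℝ) ≤ 1 / 2) (by norm_num : (0 : ℝ) ≤ 1 / 2) (by norm_num)
    rw [heven, smul_eq_mul, smul_eq_mul] at h
    refine le_trans (le_of_eq ?_) h
    congr 1
    ext t
    simp only [hR, Pi.add_apply, Pi.smul_apply, Pi.neg_apply, smul_eq_mul, mul_sub,
      Finset.sum_sub_distrib]
    ring
  calc 𝔼 s : κ → ι, Φ (fun t => ∑ j, (F (s j) t - 𝔼 i, F i t))
      ≤ 𝔼 s : κ → ι, 𝔼 s' : κ → ι, Φ (fun t => ∑ j, (F (s j) t - F (s' j) t)) :=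
        Finset.expect_le_expect fun s _ => step1 s
    _ = 𝔼 ξ : κ → Bool, 𝔼 s : κ → ι, 𝔼 s' : κ → ι,
          Φ (fun t => ∑ j, boolSign (ξ j) * (F (s j) t - F (s' j) t)) := by
        rw [← Fintype.expect_const (ι := κ → Bool)
          (𝔼 s : κ → ι, 𝔼 s' : κ → ι, Φ (fun t => ∑ j, (F (s j) t - F (s' j) t)))]
        exact Finset.expect_congr rfl fun ξ _ => step2 ξ
    _ ≤ 𝔼 ξ : κ → Bool, 𝔼 s : κ → ι, 𝔼 s' : κ → ι,
          (1 / 2 * Φ (R ξ s) + 1 / 2 * Φ (R ξ s')) :=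
        Finset.expect_le_expect fun ξ _ => Finset.expect_le_expect fun s _ =>
          Finset.expect_le_expect fun s' _ => step3 ξ s s'
    _ = 𝔼 ξ : κ → Bool, 𝔼 s : κ → ι, Φ (R ξ s) := by
        refine Finset.expect_congr rfl fun ξ _ => ?_
        simp_rw [Finset.expect_add_distrib, Fintype.expect_const, ← Finset.mul_expect]
        ring
    _ = _ := Finset.expect_comm _ _ _

/-- Hoeffding's comparison: for convex functions of the sum, a uniformly random `m`-subset is
dominated by `m` independent uniform draws. After averaging over all permutations of the population,
a fixed sequence of draws may be assumed to run inside a fixed `m`-subset, whose sum is the average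
of the sums over the cyclic shifts of the sequence. -/
theorem expect_powersetCard_le_expect_draws {T : Type*} {Φ : (T → ℝ) → ℝ}
    (hΦ : ConvexOn ℝ Set.univ Φ) {n m : ℕ} [NeZero n] [NeZero m] (hmn : m ≤ n)
    (F : Fin n → T → ℝ) :
    𝔼 S ∈ Finset.powersetCard m (Finset.univ : Finset (Fin n)), Φ (fun t => ∑ i ∈ S, F i t) ≤
      𝔼 s : Fin m → Fin n, Φ (fun t => ∑ j, F (s j) t) := by
  set 𝒮 := Finset.powersetCard m (Finset.univ : Finset (Fin n)) with h𝒮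
  have h𝒮ne : 𝒮.Nonempty := Finset.powersetCard_nonempty.2 (by simpa using hmn)
  -- a fixed subset and a fixed sequence of draws are compared after averaging over permutations
  have hfix : ∀ S ∈ 𝒮, ∀ s : Fin m → Fin n,
      𝔼 π : Equiv.Perm (Fin n), Φ (fun t => ∑ i ∈ S, F (π i) t) ≤
        𝔼 π : Equiv.Perm (Fin n), Φ (fun t => ∑ j, F (π (s j)) t) := by
    intro S hS s
    have hScard : S.card = m := (Finset.mem_powersetCard.1 hS).2
    set U : Finset (Fin n) := Finset.univ.image s with hU
    have hUm : U.card ≤ S.card := by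
      rw [hScard]; exact Finset.card_image_le.trans (by simp)
    obtain ⟨S', hS'S, hS'card⟩ := Finset.exists_subset_card_eq hUm
    let eU : {x // x ∈ U} ≃ {x // x ∈ S'} := Finset.equivOfCardEq hS'card.symm
    let τ : Equiv.Perm (Fin n) := eU.extendSubtype
    have hτ : ∀ j, τ (s j) ∈ S := fun j => by
      have hj : s j ∈ U := Finset.mem_image_of_mem _ (Finset.mem_univ j)
      exact hS'S (Equiv.extendSubtype_mem eU (s j) hj)
    let e : Fin m ≃ S := (Finset.equivFinOfCardEq hScard).symm
    let h : Fin m → Fin m := fun j => e.symm ⟨τ (s j), hτ j⟩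
    have hh : ∀ j, τ (s j) = (e (h j) : Fin n) := fun j => by simp [h]
    let σ : Fin m → Equiv.Perm (Fin n) := fun c =>
      Equiv.Perm.ofSubtype (p := fun x => x ∈ S) ((e.symm.trans (Equiv.addRight c)).trans e)
    have hσ : ∀ c a, σ c (e a : Fin n) = (e (a + c) : Fin n) := fun c a => by
      simp [σ, Equiv.Perm.ofSubtype_apply_coe]
    have hshift : ∀ c : Fin m, 𝔼 π : Equiv.Perm (Fin n), Φ (fun t => ∑ j, F (π (s j)) t) =
        𝔼 π : Equiv.Perm (Fin n), Φ (fun t => ∑ j, F (π (e (h j + c))) t) := by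
      intro c
      refine Fintype.expect_equiv (Equiv.mulRight (τ⁻¹ * (σ c)⁻¹)) _ _ fun π => ?_
      congr 1
      ext t
      refine Finset.sum_congr rfl fun j _ => ?_
      simp [← hσ, ← hh, Equiv.Perm.mul_apply]
    calc 𝔼 π : Equiv.Perm (Fin n), Φ (fun t => ∑ i ∈ S, F (π i) t)
        = 𝔼 π : Equiv.Perm (Fin n), Φ (fun t => 𝔼 c : Fin m, ∑ j, F (π (e (h j + c))) t) := by
          refine Finset.expect_congr rfl fun π _ => ?_
          congr 1
          ext t
          have hm0 : (m : ℝ) ≠ 0 := by exact_mod_cast NeZero.ne m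
          rw [Finset.expect_sum_comm]
          have h1 : ∀ j, 𝔼 c : Fin m, F (π (e (h j + c))) t = (∑ i ∈ S, F (π i) t) / m := by
            intro j
            rw [Fintype.expect_eq_sum_div_card, Fintype.card_fin]
            congr 1
            exact (Equiv.sum_comp (Equiv.addLeft (h j)) (fun a => F (π (e a)) t)).trans
              ((Equiv.sum_comp e (fun i : S => F (π i) t)).trans
                (Finset.sum_coe_sort S (fun i => F (π i) t)))
          rw [Finset.sum_congr rfl fun j _ => h1 j]
          simp
          field_simp
      _ ≤ 𝔼 π : Equiv.Perm (Fin n), 𝔼 c : Fin m, Φ (fun t => ∑ j, F (π (e (h j + c))) t) :=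
          Finset.expect_le_expect fun π _ =>
            hΦ.map_expect_le fun (c : Fin m) t => ∑ j, F (π (e (h j + c))) t
      _ = 𝔼 c : Fin m, 𝔼 π : Equiv.Perm (Fin n), Φ (fun t => ∑ j, F (π (e (h j + c))) t) :=
          Finset.expect_comm _ _ _
      _ = 𝔼 _c : Fin m, 𝔼 π : Equiv.Perm (Fin n), Φ (fun t => ∑ j, F (π (s j)) t) :=
          Finset.expect_congr rfl fun c _ => (hshift c).symm
      _ = _ := Fintype.expect_const _
  have hleft : ∀ π : Equiv.Perm (Fin n), 𝔼 S ∈ 𝒮, Φ (fun t => ∑ i ∈ S, F i t) =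
      𝔼 S ∈ 𝒮, Φ (fun t => ∑ i ∈ S, F (π i) t) := by
    intro π
    refine (Finset.expect_equiv (Equiv.finsetCongr π) (fun S => ?_) fun S _ => ?_).symm
    · simp [h𝒮, Finset.mem_powersetCard]
    · simp
  have hright : ∀ π : Equiv.Perm (Fin n), 𝔼 s : Fin m → Fin n, Φ (fun t => ∑ j, F (s j) t) =
      𝔼 s : Fin m → Fin n, Φ (fun t => ∑ j, F (π (s j)) t) := by
    intro π
    exact (Fintype.expect_equiv (Equiv.piCongrRight fun _ => π) _ _ fun s => by simp).symm
  calc 𝔼 S ∈ 𝒮, Φ (fun t => ∑ i ∈ S, F i t)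
      = 𝔼 π : Equiv.Perm (Fin n), 𝔼 S ∈ 𝒮, Φ (fun t => ∑ i ∈ S, F (π i) t) := by
        rw [← Finset.expect_congr rfl fun π _ => hleft π, Fintype.expect_const]
    _ = 𝔼 S ∈ 𝒮, 𝔼 π : Equiv.Perm (Fin n), Φ (fun t => ∑ i ∈ S, F (π i) t) :=
        Finset.expect_comm _ _ _
    _ ≤ 𝔼 s : Fin m → Fin n, 𝔼 π : Equiv.Perm (Fin n), Φ (fun t => ∑ j, F (π (s j)) t) :=
        Finset.expect_le h𝒮ne fun S hS =>
          Finset.le_expect Finset.univ_nonempty fun s _ => hfix S hS s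
    _ = 𝔼 π : Equiv.Perm (Fin n), 𝔼 s : Fin m → Fin n, Φ (fun t => ∑ j, F (π (s j)) t) :=
        Finset.expect_comm _ _ _
    _ = _ := by
        rw [← Finset.expect_congr rfl fun π _ => hright π, Fintype.expect_const]

/-! ### Chaining for Rademacher sums -/

/-- The largest of the values `exp (lam * |v t|)`; an exponential moment of the supremum of a
finite process is an average of `supExp`. -/
noncomputable def supExp {T : Type*} [Fintype T] [Nonempty T] (lam : ℝ) (v : T → ℝ) : ℝ :=
  Finset.univ.sup' Finset.univ_nonempty fun t => Real.exp (lam * |v t|)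

section SupExp

variable {T : Type*} [Fintype T] [Nonempty T] {lam : ℝ} {v : T → ℝ}

theorem exp_le_supExp (lam : ℝ) (v : T → ℝ) (t : T) : Real.exp (lam * |v t|) ≤ supExp lam v :=
  Finset.le_sup' (fun t => Real.exp (lam * |v t|)) (Finset.mem_univ t)

theorem supExp_le {c : ℝ} (h : ∀ t, Real.exp (lam * |v t|) ≤ c) : supExp lam v ≤ c :=
  Finset.sup'_le _ _ fun t _ => h t

theorem exists_supExp_eq (lam : ℝ) (v : T → ℝ) : ∃ t, supExp lam v = Real.exp (lam * |v t|) := by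
  obtain ⟨t, -, ht⟩ := Finset.exists_mem_eq_sup' (Finset.univ_nonempty (α := T))
    fun t => Real.exp (lam * |v t|)
  exact ⟨t, ht⟩

theorem supExp_pos (lam : ℝ) (v : T → ℝ) : 0 < supExp lam v := by
  obtain ⟨t, ht⟩ := exists_supExp_eq lam v
  rw [ht]; exact Real.exp_pos _

theorem supExp_neg (lam : ℝ) (v : T → ℝ) : supExp lam (-v) = supExp lam v := by
  simp [supExp]

theorem supExp_two_mul (lam : ℝ) (v : T → ℝ) :
    supExp lam (fun t => 2 * v t) = supExp (2 * lam) v := by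
  unfold supExp
  congr 1
  ext t
  rw [abs_mul, abs_two]
  ring_nf

theorem convexOn_supExp (hlam : 0 ≤ lam) :
    ConvexOn ℝ Set.univ (supExp lam : (T → ℝ) → ℝ) := by
  refine ⟨convex_univ, fun u _ v _ a b ha hb hab => supExp_le fun t => ?_⟩
  have h1 : lam * |(a • u + b • v) t| ≤ a • (lam * |u t|) + b • (lam * |v t|) := by
    simp only [Pi.add_apply, Pi.smul_apply, smul_eq_mul]
    have h2 : |a * u t + b * v t| ≤ a * |u t| + b * |v t| := by
      refine (abs_add_le _ _).trans (le_of_eq ?_)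
      rw [abs_mul, abs_mul, abs_of_nonneg ha, abs_of_nonneg hb]
    nlinarith
  refine (Real.exp_le_exp.2 h1).trans ((convexOn_exp.2 (Set.mem_univ _) (Set.mem_univ _)
    ha hb hab).trans ?_)
  simp only [smul_eq_mul]
  gcongr <;> exact exp_le_supExp _ _ _

end SupExp

/-- Signed sums are sub-Gaussian, because `cosh x ≤ exp (x ^ 2 / 2)`. -/
theorem expect_exp_signed_sum_le {κ : Type*} [Fintype κ] [DecidableEq κ] (a : ℝ) (g : κ → ℝ) :
    𝔼 ξ : κ → Bool, Real.exp (a * ∑ j, boolSign (ξ j) * g j) ≤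
      Real.exp (a ^ 2 * (∑ j, g j ^ 2) / 2) := by
  have h1 : ∀ ξ : κ → Bool, Real.exp (a * ∑ j, boolSign (ξ j) * g j) =
      ∏ j, Real.exp (a * (boolSign (ξ j) * g j)) := fun ξ => by
    rw [Finset.mul_sum, Real.exp_sum]
  have h2 := Finset.prod_univ_sum (fun _ : κ => (Finset.univ : Finset Bool))
    (fun j b => Real.exp (a * (boolSign b * g j)))
  rw [Fintype.piFinset_univ] at h2
  rw [Fintype.expect_eq_sum_div_card, Finset.sum_congr rfl fun ξ _ => h1 ξ, ← h2]
  have h3 : (∏ j : κ, ∑ b : Bool, Real.exp (a * (boolSign b * g j))) / (Fintype.card (κ → Bool) : ℝ)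
      = ∏ j : κ, Real.cosh (a * g j) := by
    rw [Fintype.card_fun, Fintype.card_bool]
    push_cast
    rw [← Finset.card_univ, ← Finset.prod_const, ← Finset.prod_div_distrib]
    refine Finset.prod_congr rfl fun j _ => ?_
    rw [Fintype.sum_bool, Real.cosh_eq]
    simp [boolSign]
  rw [h3]
  calc ∏ j : κ, Real.cosh (a * g j) ≤ ∏ j : κ, Real.exp ((a * g j) ^ 2 / 2) :=
        Finset.prod_le_prod (fun j _ => (Real.cosh_pos _).le)
          fun j _ => Real.cosh_le_exp_half_sq _
    _ = _ := by
        rw [← Real.exp_sum]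
        congr 1
        rw [Finset.mul_sum, Finset.sum_div]
        exact Finset.sum_congr rfl fun j _ => by ring

theorem expect_exp_abs_signed_sum_le {κ : Type*} [Fintype κ] [DecidableEq κ] {a V : ℝ}
    {g : κ → ℝ} (hg : ∑ j, g j ^ 2 ≤ V) :
    𝔼 ξ : κ → Bool, Real.exp (a * |∑ j, boolSign (ξ j) * g j|) ≤
      2 * Real.exp (a ^ 2 * V / 2) := by
  have h1 : ∀ x : ℝ, Real.exp (a * |x|) ≤ Real.exp (a * x) + Real.exp (-a * x) := fun x => by
    rcases abs_choice x with h | h <;> rw [h]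
    · linarith [Real.exp_pos (-a * x)]
    · rw [mul_neg, neg_mul]; linarith [Real.exp_pos (a * x)]
  have h2 : ∀ b : ℝ, b ^ 2 = a ^ 2 →
      𝔼 ξ : κ → Bool, Real.exp (b * ∑ j, boolSign (ξ j) * g j) ≤ Real.exp (a ^ 2 * V / 2) := by
    intro b hb
    refine (expect_exp_signed_sum_le b g).trans (Real.exp_le_exp.2 ?_)
    rw [hb]
    have := mul_le_mul_of_nonneg_left hg (sq_nonneg a)
    linarith
  calc _ ≤ 𝔼 ξ : κ → Bool, (Real.exp (a * ∑ j, boolSign (ξ j) * g j) +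
          Real.exp (-a * ∑ j, boolSign (ξ j) * g j)) :=
        Finset.expect_le_expect fun ξ _ => h1 _
    _ ≤ _ := by
        rw [Finset.expect_add_distrib]
        linarith [h2 a rfl, h2 (-a) (by ring)]

theorem pow_expect_le_expect_pow {ι : Type*} [Fintype ι] [Nonempty ι] {f : ι → ℝ}
    (hf : ∀ i, 0 ≤ f i) (p : ℕ) : (𝔼 i, f i) ^ p ≤ 𝔼 i, f i ^ p := by
  have h := Real.pow_arith_mean_le_arith_mean_pow Finset.univ
    (fun _ : ι => (Fintype.card ι : ℝ)⁻¹) f (by intros; positivity) (by simp)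
    (fun i _ => hf i) p
  simpa [Fintype.expect_eq_sum_div_card, div_eq_inv_mul, Finset.mul_sum] using h

section Chain

variable {T κ : Type*} [Fintype T] [Nonempty T] [Fintype κ] [DecidableEq κ] {A V lam : ℝ}

/-- One link of the chain. At depth `i` there are at most `A ^ (i + 1) / 2` different links, and
taking the `(i + 1)`-st power before the union bound makes the cost of each depth the same. -/
theorem expect_supExp_link_le (hA : 1 ≤ A) (hV : 0 ≤ V) (i : ℕ)
    {g : T → κ → ℝ} (hcard : ∃ D : Finset (κ → ℝ), (∀ t, g t ∈ D) ∧ 2 * (D.card : ℝ) ≤ A ^ (i + 1))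
    (hvar : ∀ t, ∑ j, g t j ^ 2 ≤ 5 * (1 / 4) ^ i * V) :
    𝔼 ξ : κ → Bool, supExp (lam / ((3 / 4) ^ i / 4)) (fun t => ∑ j, boolSign (ξ j) * g t j) ≤
      A * Real.exp (40 * lam ^ 2 * V) := by
  classical
  obtain ⟨D', hD', hD'card⟩ := hcard
  set D := D'.filter fun d => ∃ t, g t = d with hD
  have hDmem : ∀ t, g t ∈ D := fun t => Finset.mem_filter.2 ⟨hD' t, t, rfl⟩
  have hDcard : 2 * (D.card : ℝ) ≤ A ^ (i + 1) := by
    have h1 : (D.card : ℝ) ≤ D'.card := by exact_mod_cast Finset.card_filter_le _ _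
    linarith
  set a : ℝ := lam / ((3 / 4) ^ i / 4) with ha
  have hexp : ((i + 1 : ℕ) * a) ^ 2 * (5 * (1 / 4) ^ i * V) / 2 ≤
      (i + 1 : ℕ) * (40 * lam ^ 2 * V) := by
    have h1 : ((i + 1 : ℕ) : ℝ) * (4 / 9) ^ i ≤ 1 := by
      have h2 : ((i + 1 : ℕ) : ℝ) ≤ 2 ^ i := by exact_mod_cast Nat.lt_two_pow_self
      calc ((i + 1 : ℕ) : ℝ) * (4 / 9) ^ i ≤ 2 ^ i * (4 / 9) ^ i := by gcongr
        _ = (8 / 9) ^ i := by rw [← mul_pow]; norm_num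
        _ ≤ 1 := pow_le_one₀ (by norm_num) (by norm_num)
    have h3 : a ^ 2 * (1 / 4) ^ i = 16 * lam ^ 2 * (4 / 9) ^ i := by
      have h4 : (4 / 9 : ℝ) ^ i = (1 / 4) ^ i / ((3 / 4) ^ i) ^ 2 := by
        rw [← pow_mul, mul_comm i 2, pow_mul, ← div_pow]; norm_num
      rw [ha, h4]; field_simp; ring
    calc ((i + 1 : ℕ) * a) ^ 2 * (5 * (1 / 4) ^ i * V) / 2
        = (i + 1 : ℕ) * (40 * lam ^ 2 * V) * ((i + 1 : ℕ) * (4 / 9) ^ i) := by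
          linear_combination ((i + 1 : ℕ) : ℝ) ^ 2 * V * 5 / 2 * h3
      _ ≤ (i + 1 : ℕ) * (40 * lam ^ 2 * V) * 1 := by gcongr
      _ = _ := mul_one _
  have hpow : (𝔼 ξ : κ → Bool, supExp a (fun t => ∑ j, boolSign (ξ j) * g t j)) ^ (i + 1) ≤
      (A * Real.exp (40 * lam ^ 2 * V)) ^ (i + 1) := by
    calc _ ≤ 𝔼 ξ : κ → Bool, supExp a (fun t => ∑ j, boolSign (ξ j) * g t j) ^ (i + 1) :=
          pow_expect_le_expect_pow (fun ξ => (supExp_pos _ _).le) _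
      _ ≤ 𝔼 ξ : κ → Bool, ∑ d ∈ D,
            Real.exp ((i + 1 : ℕ) * a * |∑ j, boolSign (ξ j) * d j|) := by
          refine Finset.expect_le_expect fun ξ _ => ?_
          obtain ⟨t, ht⟩ := exists_supExp_eq a (fun t => ∑ j, boolSign (ξ j) * g t j)
          rw [ht, ← Real.exp_nat_mul, ← mul_assoc]
          exact Finset.single_le_sum (f := fun d : κ → ℝ =>
            Real.exp ((i + 1 : ℕ) * a * |∑ j, boolSign (ξ j) * d j|))
            (fun d _ => (Real.exp_pos _).le) (hDmem t)
      _ = ∑ d ∈ D, 𝔼 ξ : κ → Bool,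
            Real.exp ((i + 1 : ℕ) * a * |∑ j, boolSign (ξ j) * d j|) :=
          Finset.expect_sum_comm _ _ _
      _ ≤ ∑ d ∈ D, 2 * Real.exp ((i + 1 : ℕ) * (40 * lam ^ 2 * V)) := by
          refine Finset.sum_le_sum fun d hd => ?_
          obtain ⟨t, rfl⟩ := (Finset.mem_filter.1 hd).2
          refine (expect_exp_abs_signed_sum_le (hvar t)).trans ?_
          gcongr
      _ = 2 * D.card * Real.exp ((i + 1 : ℕ) * (40 * lam ^ 2 * V)) := by
          rw [Finset.sum_const, nsmul_eq_mul]; ring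
      _ ≤ A ^ (i + 1) * Real.exp ((i + 1 : ℕ) * (40 * lam ^ 2 * V)) := by gcongr
      _ = _ := by rw [mul_pow, ← Real.exp_nat_mul]
  exact le_of_pow_le_pow_left₀ (Nat.succ_ne_zero i) (by positivity) hpow

/-- A chain of any length costs no more than a single link: the exponential of the sum is a convex
combination of the exponentials of the rescaled links, with the weights `(3 / 4) ^ i / 4`. -/
theorem expect_supExp_chain_le (hA : 1 ≤ A) (hV : 0 ≤ V) (hlam : 0 ≤ lam)
    {g : ℕ → T → κ → ℝ}
    (hcard : ∀ i, ∃ D : Finset (κ → ℝ), (∀ t, g i t ∈ D) ∧ 2 * (D.card : ℝ) ≤ A ^ (i + 1))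
    (hvar : ∀ i t, ∑ j, g i t j ^ 2 ≤ 5 * (1 / 4) ^ i * V) (L : ℕ) :
    𝔼 ξ : κ → Bool, supExp lam
        (fun t => ∑ i ∈ Finset.range L, ∑ j, boolSign (ξ j) * g i t j) ≤
      A * Real.exp (40 * lam ^ 2 * V) := by
  set K := A * Real.exp (40 * lam ^ 2 * V) with hK
  have hK1 : 1 ≤ K := one_le_mul_of_one_le_of_one_le hA (Real.one_le_exp (by positivity))
  set θ : ℕ → ℝ := fun i => (3 / 4) ^ i / 4 with hθ
  have hθ0 : ∀ i, 0 < θ i := fun i => by simp only [hθ]; positivity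
  have hθsum : (3 / 4 : ℝ) ^ L + ∑ i ∈ Finset.range L, θ i = 1 := by
    simp only [hθ]
    rw [← Finset.sum_div, geom_sum_eq (by norm_num)]
    ring
  have hpt : ∀ ξ : κ → Bool, supExp lam
      (fun t => ∑ i ∈ Finset.range L, ∑ j, boolSign (ξ j) * g i t j) ≤
      (3 / 4) ^ L + ∑ i ∈ Finset.range L,
        θ i * supExp (lam / θ i) (fun t => ∑ j, boolSign (ξ j) * g i t j) := by
    intro ξ
    refine supExp_le fun t => ?_
    set Y : ℕ → ℝ := fun i => ∑ j, boolSign (ξ j) * g i t j with hY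
    have h1 : lam * |∑ i ∈ Finset.range L, Y i| ≤
        (3 / 4 : ℝ) ^ L • (0 : ℝ) + ∑ i ∈ Finset.range L, θ i • (lam / θ i * |Y i|) := by
      have h2 : ∀ i, θ i • (lam / θ i * |Y i|) = lam * |Y i| := fun i => by
        have := (hθ0 i).ne'
        rw [smul_eq_mul]; field_simp
      rw [smul_zero, zero_add, Finset.sum_congr rfl fun i _ => h2 i, ← Finset.mul_sum]
      gcongr
      exact Finset.abs_sum_le_sum_abs _ _
    have h3 := convexOn_exp.map_add_sum_le (t := Finset.range L) (w := θ)
      (p := fun i => lam / θ i * |Y i|) (v := (3 / 4 : ℝ) ^ L) (q := 0)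
      (fun i _ => (hθ0 i).le) hθsum (fun _ _ => Set.mem_univ _) (by positivity) (Set.mem_univ _)
    refine (Real.exp_le_exp.2 h1).trans (h3.trans ?_)
    simp only [smul_eq_mul, Real.exp_zero, mul_one]
    gcongr with i _
    exact exp_le_supExp (lam / θ i) (fun t => ∑ j, boolSign (ξ j) * g i t j) t
  calc _ ≤ 𝔼 ξ : κ → Bool, ((3 / 4) ^ L + ∑ i ∈ Finset.range L,
        θ i * supExp (lam / θ i) (fun t => ∑ j, boolSign (ξ j) * g i t j)) :=
        Finset.expect_le_expect fun ξ _ => hpt ξ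
    _ = (3 / 4) ^ L + ∑ i ∈ Finset.range L, θ i *
        𝔼 ξ : κ → Bool, supExp (lam / θ i) (fun t => ∑ j, boolSign (ξ j) * g i t j) := by
        rw [Finset.expect_add_distrib, Fintype.expect_const, Finset.expect_sum_comm]
        simp_rw [← Finset.mul_expect]
    _ ≤ (3 / 4) ^ L * K + ∑ i ∈ Finset.range L, θ i * K := by
        refine add_le_add (le_mul_of_one_le_right (by positivity) hK1)
          (Finset.sum_le_sum fun i _ => mul_le_mul_of_nonneg_left ?_ (hθ0 i).le)
        exact expect_supExp_link_le hA hV i (hcard i) (hvar i)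
    _ = K := by rw [← Finset.sum_mul, ← add_mul, hθsum, one_mul]

end Chain

/-! ### Rademacher sums over a family of bounded VC-dimension -/

open scoped Classical in
/-- The probability that a random location, equal to `x l` with probability `w l`, lies in `t`. -/
noncomputable def hitProb {Λ α : Type*} [Fintype Λ] (w : Λ → ℝ) (x : Λ → α) (t : Finset α) : ℝ :=
  ∑ l, if x l ∈ t then w l else 0

section HitProb

variable {Λ α : Type*} [Fintype Λ]

theorem hitProb_nonneg {w : Λ → ℝ} (hw : ∀ l, 0 ≤ w l) (x : Λ → α) (t : Finset α) :
    0 ≤ hitProb w x t := by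
  refine Finset.sum_nonneg fun l _ => ?_
  split_ifs; exacts [hw l, le_rfl]

theorem hitProb_le_one {w : Λ → ℝ} (hw : ∀ l, 0 ≤ w l) (hw1 : ∑ l, w l = 1) (x : Λ → α)
    (t : Finset α) : hitProb w x t ≤ 1 := by
  rw [← hw1]
  refine Finset.sum_le_sum fun l _ => ?_
  split_ifs; exacts [le_rfl, hw l]

theorem abs_hitProb_sub_le {w : Λ → ℝ} (hw : ∀ l, 0 ≤ w l) (x : Λ → α) (t u : Finset α) :
    |hitProb w x t - hitProb w x u| ≤ symmDiffWeight w x t u := by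
  unfold hitProb symmDiffWeight
  rw [← Finset.sum_sub_distrib]
  refine (Finset.abs_sum_le_sum_abs _ _).trans (Finset.sum_le_sum fun l _ => ?_)
  by_cases h1 : x l ∈ t <;> by_cases h2 : x l ∈ u <;> simp [h1, h2, abs_of_nonneg (hw l)]

variable {κ : Type*} [Fintype κ] [Nonempty κ] {w : κ → Λ → ℝ} {x : κ → Λ → α}

theorem sum_abs_hitProb_sub_le (hw : ∀ j l, 0 ≤ w j l) (t u : Finset α) :
    ∑ j, |hitProb (w j) (x j) t - hitProb (w j) (x j) u| ≤ Fintype.card κ *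
      symmDiffWeight (fun q : κ × Λ => w q.1 q.2 / Fintype.card κ) (fun q => x q.1 q.2) t u := by
  refine (Finset.sum_le_sum fun j _ => abs_hitProb_sub_le (hw j) (x j) t u).trans (le_of_eq ?_)
  unfold symmDiffWeight
  rw [Fintype.sum_prod_type, Finset.mul_sum]
  refine Finset.sum_congr rfl fun j _ => ?_
  rw [Finset.mul_sum]
  refine Finset.sum_congr rfl fun l _ => ?_
  have : (Fintype.card κ : ℝ) ≠ 0 := by exact_mod_cast Fintype.card_ne_zero
  split_ifs
  · simp
  · field_simp

theorem abs_boolSign (b : Bool) : |boolSign b| = 1 := by cases b <;> simp [boolSign]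

/-- Exponential moment of the supremum of the Rademacher process of hitting probabilities. The
links of the chain join nets at the scales `(1 / 4) ^ i`; since hitting probabilities lie in
`[0, 1]`, the variance of a link is at most the distance of its ends. -/
theorem expect_supExp_hitProb_le [DecidableEq κ] [DecidableEq α] (hw : ∀ j l, 0 ≤ w j l)
    (hw1 : ∀ j, ∑ l, w j l = 1) {𝒯 : Finset (Finset α)} [Nonempty 𝒯] {ν : ℕ} (hν1 : 1 ≤ ν)
    (hν : 𝒯.vcDim ≤ ν) {lam : ℝ} (hlam : 0 ≤ lam) :
    𝔼 ξ : κ → Bool, supExp lam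
        (fun t : 𝒯 => ∑ j, boolSign (ξ j) * hitProb (w j) (x j) t) ≤
      Real.exp 1 * 4 ^ (4 * ν) * Real.exp (40 * lam ^ 2 * Fintype.card κ) := by
  set V : ℝ := (Fintype.card κ : ℝ) with hV
  have hV0 : 0 < V := by rw [hV]; exact_mod_cast Fintype.card_pos
  set p : κ × Λ → ℝ := fun q => w q.1 q.2 / V with hp
  set loc : κ × Λ → α := fun q => x q.1 q.2
  have hp0 : ∀ q, 0 ≤ p q := fun q => div_nonneg (hw _ _) hV0.le
  have hp1 : ∑ q, p q = 1 := by
    simp only [hp, Fintype.sum_prod_type, ← Finset.sum_div, hw1]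
    rw [Finset.sum_const, nsmul_eq_mul, mul_one, Finset.card_univ, div_self hV0.ne']
  set f : Finset α → κ → ℝ := fun t j => hitProb (w j) (x j) t with hf
  have hf0 : ∀ t j, 0 ≤ f t j := fun t j => hitProb_nonneg (hw j) _ _
  have hf1 : ∀ t j, f t j ≤ 1 := fun t j => hitProb_le_one (hw j) (hw1 j) _ _
  have hfd : ∀ t u, ∑ j, |f t j - f u j| ≤ V * symmDiffWeight p loc t u := fun t u =>
    sum_abs_hitProb_sub_le hw t u
  have hnets : ∀ i : ℕ, ∃ π : Finset α → Finset α,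
      (∀ t ∈ 𝒯, symmDiffWeight p loc t (π t) ≤ (1 / 4) ^ i) ∧
      ((𝒯.image π).card : ℝ) ≤ 2 * (4 / (1 / 4) ^ i) ^ (2 * ν) := fun i =>
    exists_net hp0 hp1 (by positivity) (pow_le_one₀ (by norm_num) (by norm_num)) hν
  choose π hπ hπcard using hnets
  have hNcard : ∀ i, ((𝒯.image (π i)).card : ℝ) ≤ 2 * 4 ^ ((i + 1) * (2 * ν)) := by
    intro i
    refine (hπcard i).trans (le_of_eq ?_)
    have h4 : (4 : ℝ) / (1 / 4) ^ i = 4 ^ (i + 1) := by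
      rw [one_div, inv_pow, div_inv_eq_mul, pow_succ, mul_comm]
    rw [h4, ← pow_mul]
  let g : ℕ → 𝒯 → κ → ℝ := fun i t => match i with
    | 0 => f (π 0 t)
    | i + 1 => f (π (i + 1) t) - f (π i t)
  have htel : ∀ L (t : 𝒯) j, ∑ i ∈ Finset.range (L + 1), g i t j = f (π L t) j := by
    intro L t j
    induction L with
    | zero => simp [g]
    | succ L ih => rw [Finset.sum_range_succ, ih]; simp [g]
  have hcard : ∀ i, ∃ D : Finset (κ → ℝ), (∀ t, g i t ∈ D) ∧
      2 * (D.card : ℝ) ≤ ((4 : ℝ) ^ (4 * ν)) ^ (i + 1) := by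
    intro i
    cases i with
    | zero =>
      refine ⟨(𝒯.image (π 0)).image f, fun t => Finset.mem_image_of_mem _
        (Finset.mem_image_of_mem _ t.2), ?_⟩
      have h1 : (((𝒯.image (π 0)).image f).card : ℝ) ≤ (𝒯.image (π 0)).card := by
        exact_mod_cast Finset.card_image_le
      calc 2 * (((𝒯.image (π 0)).image f).card : ℝ) ≤ 2 * (2 * 4 ^ ((0 + 1) * (2 * ν))) := by
            linarith [hNcard 0]
        _ = 4 ^ (1 + 2 * ν) := by ring
        _ ≤ 4 ^ (4 * ν) := pow_le_pow_right₀ (by norm_num) (by omega)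
        _ = _ := by ring
    | succ i =>
      refine ⟨((𝒯.image (π (i + 1))) ×ˢ (𝒯.image (π i))).image fun q => f q.1 - f q.2,
        fun t => Finset.mem_image.2 ⟨(π (i + 1) t, π i t), Finset.mem_product.2
          ⟨Finset.mem_image_of_mem _ t.2, Finset.mem_image_of_mem _ t.2⟩, rfl⟩, ?_⟩
      set P := (𝒯.image (π (i + 1))) ×ˢ (𝒯.image (π i)) with hP
      have h1 : ((P.image fun q => f q.1 - f q.2).card : ℝ) ≤
          (𝒯.image (π (i + 1))).card * (𝒯.image (π i)).card := by
        have := Finset.card_image_le (s := P) (f := fun q => f q.1 - f q.2)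
        rw [hP, Finset.card_product] at this
        exact_mod_cast this
      have h2 : ((𝒯.image (π (i + 1))).card : ℝ) * (𝒯.image (π i)).card ≤
          (2 * 4 ^ ((i + 1 + 1) * (2 * ν))) * (2 * 4 ^ ((i + 1) * (2 * ν))) := by
        gcongr <;> exact hNcard _
      calc 2 * ((P.image fun q => f q.1 - f q.2).card : ℝ)
          ≤ 4 * ((2 * 4 ^ ((i + 1 + 1) * (2 * ν))) * (2 * 4 ^ ((i + 1) * (2 * ν)))) := by
            have : (0 : ℝ) ≤ ((P.image fun q => f q.1 - f q.2).card : ℝ) := by positivity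
            linarith
        _ = 4 ^ (2 + (i + 1 + 1) * (2 * ν) + (i + 1) * (2 * ν)) := by ring
        _ ≤ 4 ^ (4 * ν * (i + 1 + 1)) := pow_le_pow_right₀ (by norm_num) (by nlinarith)
        _ = _ := by rw [pow_mul]
  have hvar : ∀ i t, ∑ j, g i t j ^ 2 ≤ 5 * (1 / 4) ^ i * V := by
    intro i t
    cases i with
    | zero =>
      calc ∑ j, g 0 t j ^ 2 ≤ ∑ _j : κ, (1 : ℝ) :=
            Finset.sum_le_sum fun j _ => pow_le_one₀ (hf0 _ _) (hf1 _ _)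
        _ = V := by simp [hV]
        _ ≤ _ := by rw [pow_zero]; linarith
    | succ i =>
      have h1 : symmDiffWeight p loc (π (i + 1) t) (π i t) ≤ 5 * (1 / 4) ^ (i + 1) := by
        have h2 := symmDiffWeight_triangle (loc := loc) hp0 (π (i + 1) t) t (π i t)
        rw [symmDiffWeight_comm (π (i + 1) t) (t : Finset α)] at h2
        have h3 := hπ (i + 1) t t.2
        have h4 := hπ i t t.2
        rw [pow_succ] at h3 ⊢
        linarith
      calc ∑ j, g (i + 1) t j ^ 2 ≤ ∑ j, |f (π (i + 1) t) j - f (π i t) j| := by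
            refine Finset.sum_le_sum fun j _ => ?_
            have h5 : |f (π (i + 1) t) j - f (π i t) j| ≤ 1 := by
              rw [abs_le]
              constructor <;> linarith [hf0 (π (i + 1) t) j, hf1 (π (i + 1) t) j,
                hf0 (π i t) j, hf1 (π i t) j]
            calc g (i + 1) t j ^ 2 = |f (π (i + 1) t) j - f (π i t) j| ^ 2 := by
                  rw [sq_abs]; rfl
              _ ≤ _ := by
                  rw [sq]; exact mul_le_of_le_one_left (abs_nonneg _) h5
        _ ≤ V * symmDiffWeight p loc (π (i + 1) t) (π i t) := hfd _ _
        _ ≤ V * (5 * (1 / 4) ^ (i + 1)) := by gcongr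
        _ = _ := mul_comm _ _
  -- a depth at which replacing a set by its neighbour in the net changes `lam` times the process
  -- by at most `1`
  obtain ⟨L, hL⟩ : ∃ L : ℕ, lam * V * (1 / 4) ^ L ≤ 1 := by
    obtain ⟨L, hL⟩ := exists_pow_lt_of_lt_one (show (0 : ℝ) < 1 / (lam * V + 1) by positivity)
      (show (1 / 4 : ℝ) < 1 by norm_num)
    refine ⟨L, ?_⟩
    rw [lt_div_iff₀ (by positivity)] at hL
    have : (0 : ℝ) < (1 / 4) ^ L := by positivity
    nlinarith
  have hchain := expect_supExp_chain_le (one_le_pow₀ (by norm_num : (1 : ℝ) ≤ 4)) hV0.le hlam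
    hcard hvar (L + 1)
  have hpt : ∀ ξ : κ → Bool, supExp lam (fun t : 𝒯 => ∑ j, boolSign (ξ j) * f t j) ≤
      Real.exp 1 * supExp lam (fun t : 𝒯 => ∑ i ∈ Finset.range (L + 1),
        ∑ j, boolSign (ξ j) * g i t j) := by
    intro ξ
    refine supExp_le fun t => ?_
    have h1 : ∑ i ∈ Finset.range (L + 1), ∑ j, boolSign (ξ j) * g i t j =
        ∑ j, boolSign (ξ j) * f (π L t) j := by
      rw [Finset.sum_comm]
      refine Finset.sum_congr rfl fun j _ => ?_
      rw [← Finset.mul_sum, htel]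
    have h2 : |∑ j, boolSign (ξ j) * f t j| ≤
        |∑ j, boolSign (ξ j) * f (π L t) j| + V * (1 / 4) ^ L := by
      have h3 : |∑ j, boolSign (ξ j) * f t j - ∑ j, boolSign (ξ j) * f (π L t) j| ≤
          V * (1 / 4) ^ L := by
        rw [← Finset.sum_sub_distrib]
        calc _ ≤ ∑ j, |boolSign (ξ j) * f t j - boolSign (ξ j) * f (π L t) j| :=
              Finset.abs_sum_le_sum_abs _ _
          _ = ∑ j, |f t j - f (π L t) j| := by
              refine Finset.sum_congr rfl fun j _ => ?_
              rw [← mul_sub, abs_mul, abs_boolSign, one_mul]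
          _ ≤ _ := (hfd _ _).trans (by gcongr; exact hπ L t t.2)
      have h4 := abs_sub_abs_le_abs_sub (∑ j, boolSign (ξ j) * f t j)
        (∑ j, boolSign (ξ j) * f (π L t) j)
      linarith
    have h5 := exp_le_supExp lam (fun t : 𝒯 => ∑ i ∈ Finset.range (L + 1),
        ∑ j, boolSign (ξ j) * g i t j) t
    simp only [h1] at h5 ⊢
    refine le_trans ?_ (mul_le_mul_of_nonneg_left h5 (Real.exp_pos 1).le)
    rw [← Real.exp_add]
    refine Real.exp_le_exp.2 ?_
    nlinarith [mul_le_mul_of_nonneg_left h2 hlam]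
  calc _ ≤ 𝔼 ξ : κ → Bool, Real.exp 1 * supExp lam (fun t : 𝒯 => ∑ i ∈ Finset.range (L + 1),
        ∑ j, boolSign (ξ j) * g i t j) := Finset.expect_le_expect fun ξ _ => hpt ξ
    _ = Real.exp 1 * 𝔼 ξ : κ → Bool, supExp lam (fun t : 𝒯 => ∑ i ∈ Finset.range (L + 1),
        ∑ j, boolSign (ξ j) * g i t j) := by rw [Finset.mul_expect]
    _ ≤ Real.exp 1 * (4 ^ (4 * ν) * Real.exp (40 * lam ^ 2 * V)) := by gcongr
    _ = _ := by ring

/-- A family of VC-dimension `0` has at most one member. -/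
theorem subsingleton_of_vcDim_eq_zero [DecidableEq α] {𝒯 : Finset (Finset α)}
    (h : 𝒯.vcDim = 0) : Subsingleton 𝒯 := by
  have h1 : 𝒯.shatterer ⊆ {∅} := fun s hs => by
    have := (Finset.mem_shatterer.1 hs).card_le_vcDim
    rw [h] at this
    simpa using this
  have h2 : 𝒯.card ≤ 1 := (Finset.card_le_card_shatterer 𝒯).trans (by
    simpa using Finset.card_le_card h1)
  rw [← Finset.card_le_one_iff_subsingleton_coe]
  exact h2

theorem expect_supExp_hitProb_le_of_subsingleton [DecidableEq κ] (hw : ∀ j l, 0 ≤ w j l)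
    (hw1 : ∀ j, ∑ l, w j l = 1) {𝒯 : Finset (Finset α)} [Nonempty 𝒯] [Subsingleton 𝒯] {lam : ℝ} :
    𝔼 ξ : κ → Bool, supExp lam
        (fun t : 𝒯 => ∑ j, boolSign (ξ j) * hitProb (w j) (x j) t) ≤
      2 * Real.exp (40 * lam ^ 2 * Fintype.card κ) := by
  obtain ⟨t₀⟩ := ‹Nonempty 𝒯›
  have h1 : ∀ ξ : κ → Bool, supExp lam
      (fun t : 𝒯 => ∑ j, boolSign (ξ j) * hitProb (w j) (x j) t) ≤
      Real.exp (lam * |∑ j, boolSign (ξ j) * hitProb (w j) (x j) t₀|) := fun ξ =>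
    supExp_le fun t => by rw [Subsingleton.elim t t₀]
  have h2 : ∑ j, hitProb (w j) (x j) (t₀ : Finset α) ^ 2 ≤ Fintype.card κ := by
    calc _ ≤ ∑ _j : κ, (1 : ℝ) := Finset.sum_le_sum fun j _ =>
          pow_le_one₀ (hitProb_nonneg (hw j) _ _) (hitProb_le_one (hw j) (hw1 j) _ _)
      _ = _ := by simp
  refine (Finset.expect_le_expect fun ξ _ => h1 ξ).trans
    ((expect_exp_abs_signed_sum_le h2).trans ?_)
  gcongr
  have : 0 ≤ lam ^ 2 * (Fintype.card κ : ℝ) := by positivity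
  linarith

end HitProb

/-! ### Densities of transversals, and the sampling bound -/

namespace UncertainPoint

variable {d k : ℕ} {ι κ : Type*}

/-- Linearity of expectation: the expected density is the mean of the hitting probabilities. -/
theorem expectedDensity_eq [Fintype ι] (P : ι → UncertainPoint d k)
    (r : Set (EuclideanSpace ℝ (Fin d))) {t : Finset (EuclideanSpace ℝ (Fin d))}
    (ht : ∀ i j, (P i).loc j ∈ t ↔ (P i).loc j ∈ r) :
    expectedDensity P r = (∑ i, hitProb (P i).prob (P i).loc t) / Fintype.card ι := by
  classical
  have h1 : ∀ φ : ι → Fin k, density (transversal P φ) r =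
      (∑ i, if (P i).loc (φ i) ∈ t then (1 : ℝ) else 0) / Fintype.card ι := by
    intro φ
    unfold density transversal
    congr 1
    rw [Nat.card_eq_fintype_card, Fintype.card_subtype, Finset.sum_boole]
    simp only [ht]
  have h2 : expectedDensity P r = ∑ φ : ι → Fin k, (∏ i, (P i).prob (φ i)) *
      ((∑ i, if (P i).loc (φ i) ∈ t then (1 : ℝ) else 0) / Fintype.card ι) := by
    unfold expectedDensity
    refine Finset.sum_congr (by congr!) fun φ _ => ?_
    rw [h1]
  rw [h2]
  simp_rw [← mul_div_assoc, Finset.mul_sum]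
  rw [← Finset.sum_div, Finset.sum_comm]
  congr 1
  refine Finset.sum_congr rfl fun i _ => ?_
  rw [sum_prod_mul_apply (p := fun i j => (P i).prob j) (fun i => (P i).prob_sum) i
    (fun j => if (P i).loc j ∈ t then (1 : ℝ) else 0)]
  unfold hitProb
  refine Finset.sum_congr rfl fun j _ => ?_
  by_cases h : (P i).loc j ∈ t <;> simp [h]

/-- A subfamily is a coreset as soon as, on every trace of a range, its sum of hitting probabilities
deviates little from its mean. -/
theorem isRECoreset_of_deviation_le {n : ℕ} [Fintype κ] [Nonempty κ]
    {P : Fin n → UncertainPoint d k} {𝒜 : Set (Set (EuclideanSpace ℝ (Fin d)))} {ε : ℝ}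
    {s : κ → Fin n}
    (h : ∀ t ∈ rangeTraces (cert P) 𝒜,
      |∑ j, (hitProb (P (s j)).prob (P (s j)).loc t - 𝔼 i, hitProb (P i).prob (P i).loc t)| ≤
        ε * Fintype.card κ) :
    IsRECoreset ε 𝒜 P s := by
  classical
  intro r hr
  set t := (cert P).filter fun x => x ∈ r with ht
  have htm : t ∈ rangeTraces (cert P) 𝒜 := by
    simp only [rangeTraces, Finset.mem_filter, Finset.mem_powerset]
    refine ⟨Finset.filter_subset _ _, r, hr, ?_⟩
    ext x; simp [ht]
  have hmem : ∀ i j, (P i).loc j ∈ t ↔ (P i).loc j ∈ r := by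
    intro i j
    have : (P i).loc j ∈ cert P := by
      unfold cert
      exact Finset.mem_image.2 ⟨(i, j), Finset.mem_univ _, rfl⟩
    simp [ht, this]
  have hc : (0 : ℝ) < Fintype.card κ := by exact_mod_cast Fintype.card_pos
  have h1 := h t htm
  rw [Finset.sum_sub_distrib, Finset.sum_const, nsmul_eq_mul, Finset.card_univ,
    Fintype.expect_eq_sum_div_card] at h1
  rw [expectedDensity_eq P r hmem, expectedDensity_eq (P ∘ s) r fun i j => hmem (s i) j,
    abs_sub_comm]
  set S := ∑ j, hitProb (P (s j)).prob (P (s j)).loc t with hS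
  set E := (∑ i, hitProb (P i).prob (P i).loc t) / (Fintype.card (Fin n) : ℝ) with hE
  have h2 : (∑ i, hitProb ((P ∘ s) i).prob ((P ∘ s) i).loc t) / (Fintype.card κ : ℝ) - E =
      (S - Fintype.card κ * E) / Fintype.card κ := by
    simp only [hS, Function.comp]
    field_simp
  rw [h2, abs_div, abs_of_pos hc, div_le_iff₀ hc]
  exact h1

/-- The complete family has no deviation at all. -/
theorem isRECoreset_univ {n : ℕ} [NeZero n] (P : Fin n → UncertainPoint d k)
    (𝒜 : Set (Set (EuclideanSpace ℝ (Fin d)))) {ε : ℝ} (hε : 0 ≤ ε) :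
    IsRECoreset ε 𝒜 P (fun i : (Finset.univ : Finset (Fin n)) => (i : Fin n)) := by
  have : Nonempty (Finset.univ : Finset (Fin n)) := ⟨⟨0, Finset.mem_univ _⟩⟩
  refine isRECoreset_of_deviation_le fun t _ => ?_
  rw [Finset.sum_coe_sort Finset.univ (fun i => hitProb (P i).prob (P i).loc t -
    𝔼 i, hitProb (P i).prob (P i).loc t), Finset.sum_sub_distrib, Finset.sum_const, nsmul_eq_mul,
    Finset.card_univ, Fintype.card_mul_expect, sub_self, abs_zero]
  positivity

end UncertainPoint

/-- The factor in front of the sub-Gaussian part of the exponential moment. -/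
noncomputable def momentFactor (ν : ℕ) : ℝ := if ν = 0 then 2 else Real.exp (7 * ν)

theorem one_lt_momentFactor (ν : ℕ) : 1 < momentFactor ν := by
  unfold momentFactor
  split_ifs with h
  · norm_num
  · have : 0 < ν := Nat.pos_of_ne_zero h
    exact Real.one_lt_exp_iff.2 (by positivity)

theorem exp_one_mul_four_pow_le {ν : ℕ} (hν : 1 ≤ ν) :
    Real.exp 1 * 4 ^ (4 * ν) ≤ Real.exp (7 * ν) := by
  have h4 : (4 : ℝ) ≤ Real.exp (3 / 2) := by
    rw [← Real.log_le_iff_le_exp (by norm_num), show (4 : ℝ) = 2 ^ 2 by norm_num, Real.log_pow]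
    have := Real.log_two_lt_d9
    push_cast; linarith
  have hν' : (1 : ℝ) ≤ ν := by exact_mod_cast hν
  calc Real.exp 1 * 4 ^ (4 * ν) ≤ Real.exp ν * Real.exp (3 / 2) ^ (4 * ν) := by
        gcongr
    _ = Real.exp (7 * ν) := by
        rw [← Real.exp_nat_mul, ← Real.exp_add]
        congr 1; push_cast; ring

open scoped Classical in
/-- Exponential moment of the largest deviation in `m` independent uniform draws. -/
theorem expect_supExp_deviation_le {ι Λ α : Type*} [Fintype ι] [Nonempty ι] [Fintype Λ]
    {w : ι → Λ → ℝ} {x : ι → Λ → α} (hw : ∀ i l, 0 ≤ w i l)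
    (hw1 : ∀ i, ∑ l, w i l = 1) {𝒯 : Finset (Finset α)} [Nonempty 𝒯] {ν : ℕ}
    (hν : 𝒯.vcDim ≤ ν) {lam : ℝ} (hlam : 0 ≤ lam) (m : ℕ) [NeZero m] :
    𝔼 s : Fin m → ι, supExp lam (fun t : 𝒯 => ∑ j, (hitProb (w (s j)) (x (s j)) t -
        𝔼 i, hitProb (w i) (x i) t)) ≤ momentFactor ν * Real.exp (160 * lam ^ 2 * m) := by
  refine (expect_symmetrization (convexOn_supExp hlam) (supExp_neg lam)
    (fun i (t : 𝒯) => hitProb (w i) (x i) t)).trans ?_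
  refine Finset.expect_le Finset.univ_nonempty fun s _ => ?_
  simp_rw [supExp_two_mul]
  have hexp : Real.exp (40 * (2 * lam) ^ 2 * Fintype.card (Fin m)) =
      Real.exp (160 * lam ^ 2 * m) := by
    rw [Fintype.card_fin]; ring_nf
  rw [← hexp]
  unfold momentFactor
  split_ifs with h0
  · have := subsingleton_of_vcDim_eq_zero (𝒯 := 𝒯) (by omega)
    exact expect_supExp_hitProb_le_of_subsingleton (w := fun j => w (s j)) (x := fun j => x (s j))
      (fun j => hw (s j)) (fun j => hw1 (s j))
  · have hν1 : 1 ≤ ν := Nat.one_le_iff_ne_zero.2 h0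
    refine (expect_supExp_hitProb_le (w := fun j => w (s j)) (x := fun j => x (s j))
      (fun j => hw (s j)) (fun j => hw1 (s j)) hν1 hν (by positivity)).trans ?_
    gcongr
    exact exp_one_mul_four_pow_le hν1

/-- Markov's inequality for a uniform choice from a finite set. -/
theorem ofReal_one_sub_le_uniformOfFinset {α : Type*} {S : Finset α} (hS : S.Nonempty) {A : Set α}
    {Z : α → ℝ} (hZ : ∀ x ∈ S, 0 ≤ Z x) {c δ : ℝ} (hc : 0 < c) (hδ : δ ≤ 1)
    (hbad : ∀ x ∈ S, x ∉ A → c ≤ Z x)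
    (hexp : 𝔼 x ∈ S, Z x ≤ δ * c) :
    ENNReal.ofReal (1 - δ) ≤ (PMF.uniformOfFinset S hS).toOuterMeasure A := by
  classical
  rw [PMF.toOuterMeasure_uniformOfFinset_apply]
  have hcard : (0 : ℝ) < S.card := by exact_mod_cast hS.card_pos
  have hsplit : ((S.filter fun x => x ∈ A).card : ℝ) + (S.filter fun x => ¬ x ∈ A).card =
      S.card := by
    exact_mod_cast Finset.card_filter_add_card_filter_not (s := S) (fun x => x ∈ A)
  have hb : ((S.filter fun x => ¬ x ∈ A).card : ℝ) * c ≤ S.card * (δ * c) := by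
    calc ((S.filter fun x => ¬ x ∈ A).card : ℝ) * c
        = ∑ x ∈ S.filter fun x => ¬ x ∈ A, c := by simp
      _ ≤ ∑ x ∈ S.filter fun x => ¬ x ∈ A, Z x := Finset.sum_le_sum fun x hx =>
          hbad x (Finset.mem_filter.1 hx).1 (Finset.mem_filter.1 hx).2
      _ ≤ ∑ x ∈ S, Z x := Finset.sum_le_sum_of_subset_of_nonneg (Finset.filter_subset _ _)
          fun x hx _ => hZ x hx
      _ = S.card * 𝔼 x ∈ S, Z x := (Finset.card_mul_expect S Z).symm
      _ ≤ _ := by gcongr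
  have hb' : ((S.filter fun x => ¬ x ∈ A).card : ℝ) ≤ S.card * δ := by
    rw [← mul_assoc] at hb
    exact le_of_mul_le_mul_right hb hc
  rw [ENNReal.le_div_iff_mul_le (Or.inl (by exact_mod_cast hcard.ne'))
    (Or.inl (ENNReal.natCast_ne_top _)), ← ENNReal.ofReal_natCast, ← ENNReal.ofReal_natCast,
    ← ENNReal.ofReal_mul (by linarith)]
  exact ENNReal.ofReal_le_ofReal (by linarith)

/-- The sample size is large enough for the exponential moment at `lam = ε / 320` to beat `δ`. -/
theorem momentFactor_mul_exp_le {k ν m : ℕ} {ε δ : ℝ} (hk : 1 ≤ k) (hε : 0 < ε) (hδ0 : 0 < δ)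
    (hδ1 : δ < 1) (hdeg : ν = 0 → k = 1 → δ ≤ 1 / 2)
    (hm : 4480 * ((1 / ε ^ 2) * ((ν : ℝ) + Real.log ((k : ℝ) / δ))) ≤ (m : ℝ)) :
    momentFactor ν * Real.exp (160 * (ε / 320) ^ 2 * m) ≤ δ * Real.exp (ε / 320 * (ε * m)) := by
  have hk0 : (0 : ℝ) < k := by exact_mod_cast hk
  have hlogk : 0 ≤ Real.log k := Real.log_nonneg (by exact_mod_cast hk)
  have hlogδ : Real.log δ < 0 := Real.log_neg hδ0 hδ1
  have hq : 7 * ((ν : ℝ) + (Real.log k - Real.log δ)) ≤ ε ^ 2 * m / 640 := by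
    rw [← Real.log_div hk0.ne' hδ0.ne']
    have h1 := mul_le_mul_of_nonneg_left hm (sq_nonneg ε)
    have h2 : ε ^ 2 * (4480 * ((1 / ε ^ 2) * ((ν : ℝ) + Real.log ((k : ℝ) / δ)))) =
        4480 * ((ν : ℝ) + Real.log ((k : ℝ) / δ)) := by field_simp
    linarith
  have hlog : Real.log (momentFactor ν) - Real.log δ ≤ ε ^ 2 * m / 640 := by
    refine le_trans ?_ hq
    unfold momentFactor
    split_ifs with h0
    · subst h0
      have hlog2 := Real.log_pos (one_lt_two (α := ℝ))
      rcases Nat.lt_or_ge 1 k with hk2 | hk1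
      · have : Real.log 2 ≤ Real.log k := Real.log_le_log two_pos (by exact_mod_cast hk2)
        push_cast; linarith
      · have h1 : k = 1 := le_antisymm hk1 hk
        have h2 : Real.log δ ≤ - Real.log 2 := by
          rw [← Real.log_inv]
          exact Real.log_le_log hδ0 (by simpa using hdeg rfl h1)
        push_cast; linarith
    · rw [Real.log_exp]
      linarith
  have hK : 0 < momentFactor ν := zero_lt_one.trans (one_lt_momentFactor ν)
  have hprod : ∀ {a : ℝ}, 0 < a → ∀ b, a * Real.exp b = Real.exp (Real.log a + b) := fun ha b => by
    rw [Real.exp_add, Real.exp_log ha]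
  rw [hprod hK, hprod hδ0]
  refine Real.exp_le_exp.2 ?_
  have e1 : ε / 320 * (ε * m) - 160 * (ε / 320) ^ 2 * m = ε ^ 2 * m / 640 := by ring
  linarith

namespace UncertainPoint

variable {d k n : ℕ} {P : Fin n → UncertainPoint d k}
  {𝒜 : Set (Set (EuclideanSpace ℝ (Fin d)))} {ε δ : ℝ}

/-- The difference between the hitting probability of a trace `t` for the `i`-th point and its mean
over all points. -/
noncomputable def deviation (P : Fin n → UncertainPoint d k)
    (𝒜 : Set (Set (EuclideanSpace ℝ (Fin d)))) (i : Fin n) (t : rangeTraces (cert P) 𝒜) : ℝ :=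
  hitProb (P i).prob (P i).loc t - 𝔼 i, hitProb (P i).prob (P i).loc t

theorem nonempty_rangeTraces (h𝒜 : 𝒜.Nonempty)
    (X : Finset (EuclideanSpace ℝ (Fin d))) : Nonempty (rangeTraces X 𝒜) := by
  classical
  obtain ⟨r, hr⟩ := h𝒜
  refine ⟨⟨X.filter fun x => x ∈ r, ?_⟩⟩
  simp only [rangeTraces, Finset.mem_filter, Finset.mem_powerset]
  exact ⟨Finset.filter_subset _ _, r, hr, by ext x; simp⟩

/-- A sample that is not a coreset has a deviation larger than `ε * m`. -/
theorem exp_le_supExp_of_not_isRECoreset [Nonempty (rangeTraces (cert P) 𝒜)] {κ : Type*}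
    [Fintype κ] [Nonempty κ] {s : κ → Fin n} {lam : ℝ} (hlam : 0 ≤ lam)
    (hs : ¬ IsRECoreset ε 𝒜 P s) :
    Real.exp (lam * (ε * Fintype.card κ)) ≤
      supExp lam (fun t => ∑ j, deviation P 𝒜 (s j) t) := by
  by_contra! hlt
  refine hs (isRECoreset_of_deviation_le fun t ht => ?_)
  have h1 := (exp_le_supExp lam (fun t => ∑ j, deviation P 𝒜 (s j) t) ⟨t, ht⟩).trans_lt hlt
  rw [Real.exp_lt_exp] at h1
  exact (lt_of_mul_lt_mul_left h1 hlam).le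

theorem ofReal_one_sub_le_uniformDraws [NeZero n] [Nonempty (rangeTraces (cert P) 𝒜)] {m : ℕ}
    [NeZero m] {lam : ℝ} (hlam : 0 ≤ lam) (hδ : δ ≤ 1)
    (hexp : 𝔼 s : Fin m → Fin n, supExp lam (fun t => ∑ j, deviation P 𝒜 (s j) t) ≤
      δ * Real.exp (lam * (ε * m))) :
    ENNReal.ofReal (1 - δ) ≤ (uniformDraws n m).toOuterMeasure {s | IsRECoreset ε 𝒜 P s} := by
  refine ofReal_one_sub_le_uniformOfFinset Finset.univ_nonempty
    (Z := fun s : Fin m → Fin n => supExp lam (fun t => ∑ j, deviation P 𝒜 (s j) t))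
    (fun s _ => (supExp_pos _ _).le) (Real.exp_pos _) hδ (fun s _ hs => ?_) hexp
  have h1 := exp_le_supExp_of_not_isRECoreset hlam hs
  rwa [Fintype.card_fin] at h1

theorem ofReal_one_sub_le_uniformSubset [NeZero n] [Nonempty (rangeTraces (cert P) 𝒜)] {m : ℕ}
    [NeZero m] {lam : ℝ} (hlam : 0 ≤ lam) (hε : 0 ≤ ε) (hδ0 : 0 ≤ δ) (hδ : δ ≤ 1)
    (hexp : 𝔼 s : Fin m → Fin n, supExp lam (fun t => ∑ j, deviation P 𝒜 (s j) t) ≤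
      δ * Real.exp (lam * (ε * m))) :
    ENNReal.ofReal (1 - δ) ≤ (uniformSubset n m).toOuterMeasure
      {S | IsRECoreset ε 𝒜 P (fun i : S => (i : Fin n))} := by
  unfold uniformSubset
  rcases Nat.lt_or_ge m n with hmn | hnm
  · refine ofReal_one_sub_le_uniformOfFinset _
      (Z := fun S => supExp lam (fun t => ∑ i ∈ S, deviation P 𝒜 i t))
      (fun S _ => (supExp_pos _ _).le) (Real.exp_pos _) hδ (c := Real.exp (lam * (ε * m))) ?_ ?_
    · intro S hS hSbad
      have hScard : Fintype.card S = m := by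
        rw [Fintype.card_coe, (Finset.mem_powersetCard.1 hS).2, min_eq_left hmn.le]
      have : Nonempty S := Fintype.card_pos_iff.1 (hScard ▸ Nat.pos_of_ne_zero (NeZero.ne m))
      have h1 := exp_le_supExp_of_not_isRECoreset hlam hSbad
      rw [hScard] at h1
      refine h1.trans (le_of_eq ?_)
      congr 1
      ext t
      exact Finset.sum_coe_sort S fun i => deviation P 𝒜 i t
    · rw [min_eq_left hmn.le]
      exact (expect_powersetCard_le_expect_draws (convexOn_supExp hlam) hmn.le _).trans hexp
  · refine ofReal_one_sub_le_uniformOfFinset _ (Z := fun _ => 0) (c := 1) (by simp) one_pos hδ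
      (fun S hS hSbad => absurd ?_ hSbad) (by simpa using hδ0)
    have hSu : S = Finset.univ := by
      rw [← Finset.card_eq_iff_eq_univ, (Finset.mem_powersetCard.1 hS).2, min_eq_right hnm,
        Fintype.card_fin]
    subst hSu
    exact isRECoreset_univ P 𝒜 hε

end UncertainPoint

theorem mainTheorem7 :
    ∃ C : ℝ, 0 < C ∧
      ∀ (d k n ν : ℕ) [NeZero n] (P : Fin n → UncertainPoint d k)
        (𝒜 : Set (Set (EuclideanSpace ℝ (Fin d)))) (ε δ : ℝ),
        0 < ε → ε ≤ 1 → 0 < δ → δ < 1 →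
        (ν = 0 → k = 1 → δ ≤ 1 / 2) →
        rangeSpaceVCDim (UncertainPoint.cert P) 𝒜 ≤ ν →
        ∀ m : ℕ, C * ((1 / ε ^ 2) * ((ν : ℝ) + Real.log ((k : ℝ) / δ))) ≤ (m : ℝ) →
          ENNReal.ofReal (1 - δ) ≤
              (uniformSubset n m).toOuterMeasure
                {S | UncertainPoint.IsRECoreset ε 𝒜 P (fun i : S => (i : Fin n))} ∧
          ENNReal.ofReal (1 - δ) ≤
              (uniformDraws n m).toOuterMeasure
                {s | UncertainPoint.IsRECoreset ε 𝒜 P s} := by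
  classical
  refine ⟨4480, by norm_num, ?_⟩
  intro d k n ν _ P 𝒜 ε δ hε _ hδ0 hδ1 hdeg hν m hm
  have hk : 1 ≤ k := by
    rcases Nat.eq_zero_or_pos k with rfl | h
    · simpa using (P 0).prob_sum
    · exact h
  have hmain := momentFactor_mul_exp_le hk hε hδ0 hδ1 hdeg hm
  have hm0 : m ≠ 0 := by
    rintro rfl
    have := one_lt_momentFactor ν
    simp at hmain
    linarith
  have : NeZero m := ⟨hm0⟩
  rcases 𝒜.eq_empty_or_nonempty with rfl | h𝒜
  · -- without ranges every sample is a coreset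
    have h1 : ENNReal.ofReal (1 - δ) ≤ 1 := ENNReal.ofReal_le_one.2 (by linarith)
    constructor
    · refine h1.trans (le_of_eq (Eq.symm ?_))
      exact (PMF.toOuterMeasure_apply_eq_one_iff _ _).2 fun S _ r hr =>
        absurd hr (Set.notMem_empty r)
    · refine h1.trans (le_of_eq (Eq.symm ?_))
      exact (PMF.toOuterMeasure_apply_eq_one_iff _ _).2 fun S _ r hr =>
        absurd hr (Set.notMem_empty r)
  have := UncertainPoint.nonempty_rangeTraces h𝒜 (UncertainPoint.cert P)
  have hlam : 0 ≤ ε / 320 := by positivity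
  have hdraws := (expect_supExp_deviation_le (fun i => (P i).prob_nonneg)
    (fun i => (P i).prob_sum) hν hlam m (x := fun i => (P i).loc)).trans hmain
  exact ⟨UncertainPoint.ofReal_one_sub_le_uniformSubset hlam hε.le hδ0.le hδ1.le hdraws,
    UncertainPoint.ofReal_one_sub_le_uniformDraws hlam hδ1.le hdraws⟩
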